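/- All graphs are undirected and simple. A graph is an interval graph if its vertices can be assigned intervals of the real line so that two distinct vertices are adjacent if and only if their intervals intersect. A set $X$ of vertices of a graph $G$ is a minimal forbidden set if $G[X]$ is not an interval graph but $G[X']$ is an interval graph for every proper subset $X'\subset X$. The graph $G$ is prereduced if it has no minimal forbidden set of at most $10$ vertices. A $\dagger$-AW in $G$, written $(s:c:l,B,r)$ with $B=\{b_1,\dots,b_d\}$, $d\ge 3$, $b_0=l$, $b_{d+1}=r$, is an induced subgraph of $G$ on distinct vertices $s,c,b_0,\dots,b_{d+1}$ whose edges are exactly $b_ib_{i+1}$ ($0\le i\le d$), $sc$, and $cb_i$ ($1\le i\le d$). A $\ddagger$-AW in $G$, written $(s:c_1,c_2:l,B,r)$ with $B=\{b_1,\dots,b_d\}$, $d\ge 2$, $b_0=l$, $b_{d+1}=r$, is an induced subgraph of $G$ on distinct vertices $s,c_1,c_2,b_0,\dots,b_{d+1}$ whose edges are exactly $b_ib_{i+1}$ ($0\le i\le d$), $sc_1$, $sc_2$, $c_1c_2$, $c_1b_i$ ($0\le i\le d$), and $c_2b_i$ ($1\le i\le d+1$). In both cases $s$ is called the shallow terminal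 and $B$ the base. For a vertex $s$, $N(s)$ is its set of neighbors; for a vertex set $U$, $N(U)$ is the set of vertices outside $U$ with a neighbor in $U$. Theorem. Let $W$ be a $\dagger$-AW or a $\ddagger$-AW in a prereduced graph $G$, with shallow terminal $s$ and base $B$. Let $C=N(s)\cap N(B)$ and let $M$ be the vertex set of the component of $G-C$ containing $s$. Then every vertex of $M$ is adjacent to every vertex of $C$, and $C$ induces a clique in $G$. -/

import Mathlib

/-- `G` is an interval graph: the vertices can be assigned (nonempty, closed) intervals
`[l v, r v]` of the real line such that two distinct vertices are adjacent if and only if their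
intervals intersect. -/
def IsIntervalGraph {V : Type*} (G : SimpleGraph V) : Prop :=
  ∃ l r : V → ℝ, (∀ v, l v ≤ r v) ∧
    ∀ u v, u ≠ v →
      (G.Adj u v ↔ (Set.Icc (l u) (r u) ∩ Set.Icc (l v) (r v)).Nonempty)

/-- `X` is a minimal forbidden set of `G`: `X` does not induce an interval graph, but every
proper subset of `X` does. -/
def IsMinimalForbiddenSet {V : Type*} (G : SimpleGraph V) (X : Set V) : Prop :=
  ¬ IsIntervalGraph (G.induce X) ∧ ∀ Y : Set V, Y ⊂ X → IsIntervalGraph (G.induce Y)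

/-- `G` is prereduced: it has no minimal forbidden set of at most 10 vertices. -/
def IsPrereduced {V : Type*} (G : SimpleGraph V) : Prop :=
  ∀ X : Finset V, X.card ≤ 10 → ¬ IsMinimalForbiddenSet G (X : Set V)

/-- The base part shared by both kinds of asteroidal witnesses: `b 0, b 1, …, b (d + 1)` are
distinct vertices that induce a path of `G`, in this order
(`b 0` and `b (d + 1)` are the base terminals `l` and `r`). -/
def IsInducedPath {V : Type*} (G : SimpleGraph V) (d : ℕ) (b : Fin (d + 2) → V) : Prop :=
  Function.Injective b ∧
    ∀ i j : Fin (d + 2), G.Adj (b i) (b j) ↔ (i.val + 1 = j.val ∨ j.val + 1 = i.val)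

/-- The vertices `s`, `c`, `b 0, …, b (d + 1)` induce in `G` a dagger asteroidal witness
`(s : c : b 0, {b 1, …, b d}, b (d + 1))`, with shallow terminal `s`, center `c` and
`d ≥ 3` base vertices. -/
structure IsDaggerAW {V : Type*} (G : SimpleGraph V) (d : ℕ) (s c : V) (b : Fin (d + 2) → V) :
    Prop where
  three_le : 3 ≤ d
  path : IsInducedPath G d b
  s_ne : ∀ i, s ≠ b i
  c_ne : ∀ i, c ≠ b i
  adj_s_c : G.Adj s c
  not_adj_s : ∀ i, ¬ G.Adj s (b i)
  adj_c : ∀ i : Fin (d + 2), G.Adj c (b i) ↔ (1 ≤ i.val ∧ i.val ≤ d)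

/-- The vertices `s`, `c₁`, `c₂`, `b 0, …, b (d + 1)` induce in `G` a double-dagger asteroidal
witness `(s : c₁, c₂ : b 0, {b 1, …, b d}, b (d + 1))`, with shallow terminal `s`, centers
`c₁`, `c₂` and `d ≥ 2` base vertices. -/
structure IsDoubleDaggerAW {V : Type*} (G : SimpleGraph V) (d : ℕ) (s c₁ c₂ : V)
    (b : Fin (d + 2) → V) : Prop where
  two_le : 2 ≤ d
  path : IsInducedPath G d b
  s_ne : ∀ i, s ≠ b i
  c₁_ne : ∀ i, c₁ ≠ b i
  c₂_ne : ∀ i, c₂ ≠ b i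
  adj_s_c₁ : G.Adj s c₁
  adj_s_c₂ : G.Adj s c₂
  adj_c₁_c₂ : G.Adj c₁ c₂
  not_adj_s : ∀ i, ¬ G.Adj s (b i)
  adj_c₁ : ∀ i : Fin (d + 2), G.Adj c₁ (b i) ↔ i.val ≤ d
  adj_c₂ : ∀ i : Fin (d + 2), G.Adj c₂ (b i) ↔ 1 ≤ i.val

/-- The base `{b 1, …, b d}`. -/
def baseSet {V : Type*} (d : ℕ) (b : Fin (d + 2) → V) : Set V :=
  {v | ∃ i : Fin (d + 2), 1 ≤ i.val ∧ i.val ≤ d ∧ b i = v}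

/-- The neighborhood `N(U) = N[U] \ U` of a vertex set `U`. -/
def setNeighborhood {V : Type*} (G : SimpleGraph V) (U : Set V) : Set V :=
  {v | v ∉ U ∧ ∃ u ∈ U, G.Adj u v}

/-- The set `N(s) ∩ N(B)`. -/
def commonNeighborhood {V : Type*} (G : SimpleGraph V) (s : V) (B : Set V) : Set V :=
  G.neighborSet s ∩ setNeighborhood G B

theorem self_mem_compl_commonNeighborhood {V : Type*} (G : SimpleGraph V) (s : V) (B : Set V) :
    s ∈ (commonNeighborhood G s B)ᶜ :=
  fun h => G.loopless.irrefl s h.1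

/-- The vertex set, in `G`, of the component of `G - (N(s) ∩ N(B))` containing `s`. -/
def componentAvoiding {V : Type*} (G : SimpleGraph V) (s : V) (B : Set V) : Set V :=
  Subtype.val ''
    ((G.induce (commonNeighborhood G s B)ᶜ).connectedComponentMk
      ⟨s, self_mem_compl_commonNeighborhood G s B⟩).supp

/-!
In an interval model, a walk that misses the interval of `c` stays on one side of it, so there is no
asteroidal triple. In a prereduced graph every set of at most ten vertices has an interval model,
which rules out short holes and small asteroidal triples.

Let `x ∈ C` and let `t ≠ x` be a neighbor of `s` that is not adjacent to `x`. Small asteroidal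
triples show that `x` has two neighbors on the base. Then `t` together with the vertices of the path
just before the first and just after the last base neighbor of `x` is an asteroidal triple, which
is small since `x` short-cuts the part of the base in between. So every `x ∈ C` is adjacent to all
other neighbors of `s`, and in particular `C` is a clique. If a neighbor `z ∉ C` of `s` replaces
`s`, the witness stays a witness with the same `C`, so one can walk through the whole component `M`.
-/

section IntervalModels

variable {V α : Type*} [LinearOrder α] {G : SimpleGraph V} {S : Set V} {l r : V → α}

/-- The intervals `[l v, r v]`, `v ∈ S`, represent the induced subgraph `G[S]`. The endpoints are
total functions on `V`, whose values outside `S` are irrelevant. -/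
structure IsIntervalModelOn (G : SimpleGraph V) (S : Set V) (l r : V → α) : Prop where
  le : ∀ v ∈ S, l v ≤ r v
  adj_iff : ∀ u ∈ S, ∀ v ∈ S, u ≠ v → (G.Adj u v ↔ l u ≤ r v ∧ l v ≤ r u)

namespace IsIntervalModelOn

theorem lt_or_lt_of_not_adj (h : IsIntervalModelOn G S l r) {u v : V} (hu : u ∈ S) (hv : v ∈ S)
    (huv : u ≠ v) (hadj : ¬ G.Adj u v) : r u < l v ∨ r v < l u := by
  by_contra! hle
  exact hadj ((h.adj_iff u hu v hv huv).2 hle.symm)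

theorem forall_lt_or_forall_gt_of_walk (h : IsIntervalModelOn G S l r) {a b c : V} (hc : c ∈ S)
    (hca : c ≠ a) (p : G.Walk a b) (hpS : ∀ z ∈ p.support, z ∈ S)
    (hp : ∀ z ∈ p.support, ¬ G.Adj c z) :
    (∀ z ∈ p.support, r z < l c) ∨ (∀ z ∈ p.support, r c < l z) := by
  induction p with
  | @nil a =>
    simpa [or_comm] using h.lt_or_lt_of_not_adj hc (hpS a (by simp)) hca (hp a (by simp))
  | @cons a e b hae p ih =>
    simp only [SimpleGraph.Walk.support_cons, List.forall_mem_cons] at hpS hp ⊢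
    have hce : c ≠ e := by
      rintro rfl
      exact hp.1 hae.symm
    have hmeet := (h.adj_iff a hpS.1 e (hpS.2 e p.start_mem_support) hae.ne).1 hae
    have hcc := h.le c hc
    refine (ih hce hpS.2 hp.2).imp (fun hlt => ⟨?_, hlt⟩) (fun hgt => ⟨?_, hgt⟩) <;>
      rcases h.lt_or_lt_of_not_adj hc hpS.1 hca hp.1 with hside | hside
    · have := hlt e p.start_mem_support
      order
    · exact hside
    · exact hside
    · have := hgt e p.start_mem_support
      order

/-- An interval graph has no asteroidal triple: of three pairwise disjoint intervals one lies
between the other two, and separates them. -/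
theorem not_asteroidal (h : IsIntervalModelOn G S l r) {a b c : V} (hab : a ≠ b) (hac : a ≠ c)
    (p : G.Walk a b) (q : G.Walk a c) (t : G.Walk b c)
    (hpS : ∀ z ∈ p.support, z ∈ S) (hqS : ∀ z ∈ q.support, z ∈ S) (htS : ∀ z ∈ t.support, z ∈ S)
    (hp : ∀ z ∈ p.support, ¬ G.Adj c z) (hq : ∀ z ∈ q.support, ¬ G.Adj b z)
    (ht : ∀ z ∈ t.support, ¬ G.Adj a z) : False := by
  have ha := hpS a p.start_mem_support
  have hb := hpS b p.end_mem_support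
  have hc := hqS c q.end_mem_support
  have ab_side_c := (h.forall_lt_or_forall_gt_of_walk hc hac.symm p hpS hp).imp
    (fun hz => And.intro (hz a p.start_mem_support) (hz b p.end_mem_support))
    (fun hz => And.intro (hz a p.start_mem_support) (hz b p.end_mem_support))
  have ac_side_b := (h.forall_lt_or_forall_gt_of_walk hb hab.symm q hqS hq).imp
    (fun hz => And.intro (hz a q.start_mem_support) (hz c q.end_mem_support))
    (fun hz => And.intro (hz a q.start_mem_support) (hz c q.end_mem_support))
  have bc_side_a := (h.forall_lt_or_forall_gt_of_walk ha hab t htS ht).imp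
    (fun hz => And.intro (hz b t.start_mem_support) (hz c t.end_mem_support))
    (fun hz => And.intro (hz b t.start_mem_support) (hz c t.end_mem_support))
  have := h.le a ha
  have := h.le b hb
  have := h.le c hc
  rcases ab_side_c with ⟨_, _⟩ | ⟨_, _⟩ <;> rcases ac_side_b with ⟨_, _⟩ | ⟨_, _⟩ <;>
    rcases bc_side_a with ⟨_, _⟩ | ⟨_, _⟩ <;> order

theorem adj_of_walk (h : IsIntervalModelOn G S l r) {s u v z w : V} (hs : s ∈ S) (hu : u ∈ S)
    (hv : v ∈ S) (hsu : G.Adj s u) (hsv : G.Adj s v) (huv : u ≠ v) (huz : G.Adj u z)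
    (hvw : G.Adj v w) (hsz : s ≠ z) (p : G.Walk z w) (hpS : ∀ y ∈ p.support, y ∈ S)
    (hp : ∀ y ∈ p.support, ¬ G.Adj s y) : G.Adj u v := by
  have hside := h.forall_lt_or_forall_gt_of_walk hs hsz p hpS hp
  have hsu' := (h.adj_iff s hs u hu hsu.ne).1 hsu
  have hsv' := (h.adj_iff s hs v hv hsv.ne).1 hsv
  have huz' := (h.adj_iff u hu z (hpS z p.start_mem_support) huz.ne).1 huz
  have hvw' := (h.adj_iff v hv w (hpS w p.end_mem_support) hvw.ne).1 hvw
  have := h.le s hs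
  refine (h.adj_iff u hu v hv huv).2 ?_
  rcases hside with hlt | hgt
  · have := hlt z p.start_mem_support
    have := hlt w p.end_mem_support
    constructor <;> order
  · have := hgt z p.start_mem_support
    have := hgt w p.end_mem_support
    constructor <;> order

end IsIntervalModelOn

end IntervalModels

section LocallyInterval

variable {V : Type*} {G : SimpleGraph V} {n : ℕ}

/-- Every set of at most `n` vertices of `G` induces an interval graph. -/
def IsLocallyInterval (G : SimpleGraph V) (n : ℕ) : Prop :=
  ∀ X : Finset V, X.card ≤ n → IsIntervalGraph (G.induce (X : Set V))

theorem IsLocallyInterval.mono {m : ℕ} (hG : IsLocallyInterval G n) (hmn : m ≤ n) :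
    IsLocallyInterval G m :=
  fun X hX => hG X (hX.trans hmn)

theorem IsPrereduced.isLocallyInterval (hG : IsPrereduced G) : IsLocallyInterval G 10 := by
  intro X
  induction X using Finset.strongInduction with
  | H X ih =>
    intro hX
    by_contra hn
    refine hG X hX ⟨hn, fun Y hY => ?_⟩
    lift Y to Finset V using X.finite_toSet.subset hY.subset
    rw [Finset.coe_ssubset] at hY
    exact ih Y hY ((Finset.card_le_card hY.subset).trans hX)

namespace IsLocallyInterval

theorem exists_isIntervalModelOn (hG : IsLocallyInterval G n) {L : List V} (hL : L.length ≤ n) :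
    ∃ l r : V → ℝ, IsIntervalModelOn G {v | v ∈ L} l r := by
  classical
  obtain ⟨l, r, hlr, hadj⟩ := hG L.toFinset ((List.toFinset_card_le L).trans hL)
  have mem_toFinset {v : V} (hv : v ∈ L) : v ∈ (L.toFinset : Set V) := by simpa using hv
  have extend_apply (f : ↥(L.toFinset : Set V) → ℝ) {v : V} (hv : v ∈ L) :
      Function.extend Subtype.val f 0 v = f ⟨v, mem_toFinset hv⟩ :=
    Subtype.val_injective.extend_apply f 0 ⟨v, mem_toFinset hv⟩
  refine ⟨Function.extend Subtype.val l 0, Function.extend Subtype.val r 0, ⟨?_, ?_⟩⟩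
  · intro v hv
    rw [extend_apply l hv, extend_apply r hv]
    exact hlr _
  · intro u hu v hv huv
    have huv' := hadj ⟨u, mem_toFinset hu⟩ ⟨v, mem_toFinset hv⟩ (by simpa using huv)
    rw [extend_apply l hu, extend_apply l hv, extend_apply r hu, extend_apply r hv]
    rw [SimpleGraph.induce_adj, Set.Icc_inter_Icc, Set.nonempty_Icc, sup_le_iff, le_inf_iff,
      le_inf_iff] at huv'
    rw [huv']
    have := hlr ⟨u, mem_toFinset hu⟩
    have := hlr ⟨v, mem_toFinset hv⟩
    tauto

theorem not_asteroidal (hG : IsLocallyInterval G n) (L : List V) (hL : L.length ≤ n)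
    {a b c : V} (hab : a ≠ b) (hac : a ≠ c)
    (p : G.Walk a b) (q : G.Walk a c) (t : G.Walk b c)
    (hpL : p.support ⊆ L) (hqL : q.support ⊆ L) (htL : t.support ⊆ L)
    (hp : ∀ z ∈ p.support, ¬ G.Adj c z) (hq : ∀ z ∈ q.support, ¬ G.Adj b z)
    (ht : ∀ z ∈ t.support, ¬ G.Adj a z) : False := by
  obtain ⟨l, r, h⟩ := hG.exists_isIntervalModelOn hL
  exact h.not_asteroidal hab hac p q t (fun _ hz => hpL hz) (fun _ hz => hqL hz)
    (fun _ hz => htL hz) hp hq ht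

theorem adj_of_walk (hG : IsLocallyInterval G n) {s u v z w : V} (hsu : G.Adj s u)
    (hsv : G.Adj s v) (huv : u ≠ v) (huz : G.Adj u z) (hvw : G.Adj v w) (hsz : s ≠ z)
    (p : G.Walk z w) (hn : p.length + 4 ≤ n) (hp : ∀ y ∈ p.support, ¬ G.Adj s y) :
    G.Adj u v := by
  obtain ⟨l, r, h⟩ := hG.exists_isIntervalModelOn (L := s :: u :: v :: p.support) (by simpa)
  exact h.adj_of_walk (by simp) (by simp) (by simp) hsu hsv huv huz hvw hsz p
    (fun y hy => by simp [hy]) hp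

theorem adj_of_square (hG : IsLocallyInterval G n) (hn : 4 ≤ n) {s u z v : V} (hsu : G.Adj s u)
    (huz : G.Adj u z) (hzv : G.Adj z v) (hvs : G.Adj v s) (hsz : s ≠ z) (hadj : ¬ G.Adj s z)
    (huv : u ≠ v) : G.Adj u v :=
  hG.adj_of_walk hsu hvs.symm huv huz hzv.symm hsz .nil hn (by simpa using hadj)

end IsLocallyInterval

end LocallyInterval

/-- `b 0, b 1, …, b m` are distinct vertices that induce a path of `G`, in this order. This is
`IsInducedPath` for a sequence indexed by `ℕ`, whose values beyond `m` are irrelevant. -/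
structure InducesPath {V : Type*} (G : SimpleGraph V) (m : ℕ) (b : ℕ → V) : Prop where
  injOn : Set.InjOn b (Set.Iic m)
  adj_iff : ∀ i ≤ m, ∀ j ≤ m, (G.Adj (b i) (b j) ↔ i + 1 = j ∨ j + 1 = i)

namespace InducesPath

variable {V : Type*} {G : SimpleGraph V} {n m : ℕ} {b : ℕ → V}

theorem reverse (h : InducesPath G m b) : InducesPath G m (fun i => b (m - i)) where
  injOn i hi j hj hij := by
    have := h.injOn (Set.mem_Iic.2 (m.sub_le i)) (Set.mem_Iic.2 (m.sub_le j)) hij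
    rw [Set.mem_Iic] at hi hj
    omega
  adj_iff i hi j hj := by rw [h.adj_iff _ (by omega) _ (by omega)]; omega

theorem adj_succ (h : InducesPath G m b) {i : ℕ} (hi : i + 1 ≤ m) : G.Adj (b i) (b (i + 1)) :=
  (h.adj_iff _ (by omega) _ hi).2 (Or.inl rfl)

theorem ne_of_forall_not_adj (h : InducesPath G m b) (hm : 1 ≤ m) {s : V}
    (hs : ∀ i ≤ m, ¬ G.Adj s (b i)) {i : ℕ} (hi : i ≤ m) : s ≠ b i := by
  rintro rfl
  rcases hi.lt_or_eq with hi | rfl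
  · exact hs (i + 1) hi (h.adj_succ hi)
  · obtain ⟨k, rfl⟩ := Nat.exists_eq_add_of_le' hm
    exact hs k (by omega) (h.adj_succ le_rfl).symm

theorem exists_walk (h : InducesPath G m b) {i j : ℕ} (hij : i ≤ j) (hj : j ≤ m) :
    ∃ p : G.Walk (b i) (b j), ∀ z ∈ p.support, ∃ k, i ≤ k ∧ k ≤ j ∧ b k = z := by
  induction j, hij using Nat.le_induction with
  | base => exact ⟨.nil, fun z hz => ⟨i, le_rfl, le_rfl, (List.mem_singleton.1 hz).symm⟩⟩
  | succ j hij ih =>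
    obtain ⟨p, hp⟩ := ih (by omega)
    refine ⟨p.concat (h.adj_succ hj), fun z hz => ?_⟩
    rw [SimpleGraph.Walk.support_concat, List.mem_append, List.mem_singleton] at hz
    rcases hz with hz | rfl
    · obtain ⟨k, hik, hkj, rfl⟩ := hp z hz
      exact ⟨k, hik, by omega, rfl⟩
    · exact ⟨j + 1, by omega, le_rfl, rfl⟩

theorem not_adj_add_two (h : InducesPath G m b) (hG : IsLocallyInterval G n) (hn : 4 ≤ n) {x : V}
    {k : ℕ} (hk : k + 2 ≤ m) (hx : x ≠ b (k + 1)) (hxk : G.Adj x (b k))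
    (hxk' : ¬ G.Adj x (b (k + 1))) : ¬ G.Adj x (b (k + 2)) := by
  intro hxk''
  have hne : b k ≠ b (k + 2) :=
    h.injOn.ne (Set.mem_Iic.2 (by omega)) (Set.mem_Iic.2 hk) (by omega)
  have hadj := hG.adj_of_square hn hxk (h.adj_succ (by omega)) (h.adj_succ hk) hxk''.symm hx
    hxk' hne
  rw [h.adj_iff _ (by omega) _ hk] at hadj
  omega

/-- Otherwise `s`, `b i`, `b j` would be an asteroidal triple. -/
theorem adj_last_or_adj_first (h : InducesPath G m b) (hG : IsLocallyInterval G n) {s x y : V}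
    (hs : ∀ k ≤ m, ¬ G.Adj s (b k)) (hsx : G.Adj s x) (hsy : G.Adj s y) {i j p q : ℕ}
    (hj : j ≤ m) (hn : j + 4 ≤ n + i) (hip : i ≤ p) (hpj : p + 2 ≤ j) (hiq : i + 2 ≤ q)
    (hqj : q ≤ j) (hxp : G.Adj x (b p)) (hyq : G.Adj y (b q)) :
    G.Adj x (b j) ∨ G.Adj y (b i) := by
  by_contra! hcon
  obtain ⟨hxj, hyi⟩ := hcon
  obtain ⟨P, hP⟩ := h.exists_walk hip (by omega)
  obtain ⟨Q, hQ⟩ := h.exists_walk hqj hj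
  obtain ⟨R, hR⟩ := h.exists_walk (show i ≤ j by omega) hj
  have hne {k : ℕ} (hk : k ≤ m) : s ≠ b k := h.ne_of_forall_not_adj (by omega) hs hk
  let L := s :: x :: y :: (List.range' i (j + 1 - i)).map b
  have support_subset_L {u v : V} {W : G.Walk u v} {k₁ k₂ : ℕ} (hk₁ : i ≤ k₁) (hk₂ : k₂ ≤ j)
      (hW : ∀ z ∈ W.support, ∃ k, k₁ ≤ k ∧ k ≤ k₂ ∧ b k = z) : W.support ⊆ L := by
    intro z hz
    obtain ⟨k, hk₁k, hkk₂, rfl⟩ := hW z hz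
    have : b k ∈ (List.range' i (j + 1 - i)).map b :=
      List.mem_map_of_mem (List.mem_range'_1.2 (by omega))
    simp [L, this]
  refine hG.not_asteroidal L (by simp [L]; omega) (hne (by omega)) (hne hj)
    (.cons hsx (.cons hxp P.reverse)) (.cons hsy (.cons hyq Q)) R ?_ ?_
    (support_subset_L le_rfl le_rfl hR) ?_ ?_ ?_
  · simpa [L] using support_subset_L le_rfl (by omega) hP
  · simpa [L] using support_subset_L (by omega) le_rfl hQ
  · simp only [SimpleGraph.Walk.support_cons, SimpleGraph.Walk.support_reverse,
      List.forall_mem_cons, List.mem_reverse]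
    refine ⟨fun hjs => hs j hj hjs.symm, fun hjx => hxj hjx.symm, fun z hz => ?_⟩
    obtain ⟨k, -, hkp, rfl⟩ := hP z hz
    rw [h.adj_iff _ hj _ (by omega)]
    omega
  · simp only [SimpleGraph.Walk.support_cons, List.forall_mem_cons]
    refine ⟨fun his => hs i (by omega) his.symm, fun hiy => hyi hiy.symm, fun z hz => ?_⟩
    obtain ⟨k, hqk, hkj, rfl⟩ := hQ z hz
    rw [h.adj_iff _ (by omega) _ (by omega)]
    omega
  · intro z hz
    obtain ⟨k, -, hkj, rfl⟩ := hR z hz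
    exact hs k (by omega)

end InducesPath

/-- The configuration common to both kinds of asteroidal witnesses: an induced path
`b 0, …, b (d + 1)`, a vertex `s` without neighbors on it, and two neighbors `c₁`, `c₂` of `s` that
see the whole base `b 1, …, b d`, where `c₁` misses `b (d + 1)` and `c₂` misses `b 0`. Taking
`c₁ = c₂` gives dagger witnesses. As in `InducesPath`, the path is indexed by `ℕ`. -/
structure IsWeakAW {V : Type*} (G : SimpleGraph V) (d : ℕ) (b : ℕ → V) (c₁ c₂ s : V) : Prop where
  two_le : 2 ≤ d
  path : InducesPath G (d + 1) b
  not_adj_s : ∀ i ≤ d + 1, ¬ G.Adj s (b i)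
  adj_s_c₁ : G.Adj s c₁
  adj_s_c₂ : G.Adj s c₂
  adj_c₁ : ∀ i, 1 ≤ i → i ≤ d → G.Adj c₁ (b i)
  adj_c₂ : ∀ i, 1 ≤ i → i ≤ d → G.Adj c₂ (b i)
  not_adj_c₁ : ¬ G.Adj c₁ (b (d + 1))
  not_adj_c₂ : ¬ G.Adj c₂ (b 0)

namespace IsWeakAW

variable {V : Type*} {G : SimpleGraph V} {d : ℕ} {b : ℕ → V} {c₁ c₂ s : V}

theorem reverse (h : IsWeakAW G d b c₁ c₂ s) : IsWeakAW G d (fun i => b (d + 1 - i)) c₂ c₁ s where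
  two_le := h.two_le
  path := h.path.reverse
  not_adj_s i _ := h.not_adj_s _ (by omega)
  adj_s_c₁ := h.adj_s_c₂
  adj_s_c₂ := h.adj_s_c₁
  adj_c₁ i _ _ := h.adj_c₂ _ (by omega) (by omega)
  adj_c₂ i _ _ := h.adj_c₁ _ (by omega) (by omega)
  not_adj_c₁ := by simpa using h.not_adj_c₂
  not_adj_c₂ := by simpa using h.not_adj_c₁

theorem ne_of_adj (h : IsWeakAW G d b c₁ c₂ s) {x : V} (hsx : G.Adj s x) {i : ℕ}
    (hi : i ≤ d + 1) : x ≠ b i := by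
  rintro rfl
  exact h.not_adj_s i hi hsx

theorem s_ne (h : IsWeakAW G d b c₁ c₂ s) {i : ℕ} (hi : i ≤ d + 1) : s ≠ b i :=
  h.path.ne_of_forall_not_adj (by omega) h.not_adj_s hi

section Neighbors

variable {x : V}

theorem adj_two_of_adj_one (h : IsWeakAW G d b c₁ c₂ s) (hG : IsLocallyInterval G 9)
    (hsx : G.Adj s x) (hx₁ : G.Adj x (b 1)) : G.Adj x (b 2) := by
  have htwo := h.two_le
  by_contra hx₂
  rcases h.path.adj_last_or_adj_first hG h.not_adj_s hsx h.adj_s_c₂ (i := 0) (j := 3) (p := 1)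
    (q := 2) (by omega) (by omega) (by omega) le_rfl le_rfl (by omega) hx₁
    (h.adj_c₂ 2 (by omega) htwo) with hx₃ | hc₂
  · exact h.path.not_adj_add_two hG (by omega) (by omega) (h.ne_of_adj hsx (by omega)) hx₁ hx₂ hx₃
  · exact h.not_adj_c₂ hc₂

theorem adj_pred_or_adj_succ (h : IsWeakAW G d b c₁ c₂ s) (hG : IsLocallyInterval G 9)
    (hsx : G.Adj s x) {k : ℕ} (hk : k + 4 ≤ d + 1) (hx : G.Adj x (b (k + 2))) :
    G.Adj x (b (k + 1)) ∨ G.Adj x (b (k + 3)) := by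
  by_contra! hcon
  have hlast : ¬ G.Adj x (b (k + 4)) :=
    h.path.not_adj_add_two hG (by omega) hk (h.ne_of_adj hsx (by omega)) hx hcon.2
  have hfirst : ¬ G.Adj x (b k) := fun hxk =>
    h.path.not_adj_add_two hG (by omega) (by omega) (h.ne_of_adj hsx (by omega)) hxk hcon.1 hx
  rcases h.path.adj_last_or_adj_first hG h.not_adj_s hsx hsx (i := k) (j := k + 4) (p := k + 2)
    (q := k + 2) hk (by omega) (by omega) (by omega) le_rfl (by omega) hx hx with hx' | hx'
  · exact hlast hx'
  · exact hfirst hx'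

theorem exists_ne_adj_base (h : IsWeakAW G d b c₁ c₂ s) (hG : IsLocallyInterval G 9)
    (hsx : G.Adj s x) {k : ℕ} (hk : 1 ≤ k) (hkd : k ≤ d) (hxk : G.Adj x (b k)) :
    ∃ m, 1 ≤ m ∧ m ≤ d ∧ m ≠ k ∧ G.Adj x (b m) := by
  have htwo := h.two_le
  rcases hk.eq_or_lt with rfl | hk
  · exact ⟨2, by omega, htwo, by omega, h.adj_two_of_adj_one hG hsx hxk⟩
  rcases hkd.eq_or_lt with rfl | hkd
  · have hx := h.reverse.adj_two_of_adj_one hG hsx (by simpa using hxk)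
    exact ⟨k - 1, by omega, by omega, by omega, by simpa using hx⟩
  obtain ⟨k, rfl⟩ := Nat.exists_eq_add_of_le' hk
  rcases h.adj_pred_or_adj_succ hG hsx (by omega) hxk with hx | hx
  · exact ⟨k + 1, by omega, by omega, by omega, hx⟩
  · exact ⟨k + 3, by omega, by omega, by omega, hx⟩

/-- `i + 1` is the first base index adjacent to `x`. The vertex `g` is `x` itself, unless `x` is
adjacent to `b 0`, in which case it is `c₂`. -/
theorem exists_first_adj (h : IsWeakAW G d b c₁ c₂ s) (hsx : G.Adj s x) {k : ℕ} (hk : 1 ≤ k)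
    (hkd : k ≤ d) (hxk : G.Adj x (b k)) :
    ∃ i g, i + 1 ≤ d ∧ G.Adj x (b (i + 1)) ∧ G.Adj s g ∧ ¬ G.Adj g (b i) ∧
      ∀ m, 1 ≤ m → m ≤ d → G.Adj x (b m) → i + 1 ≤ m ∧ G.Adj g (b m) := by
  classical
  have hex : ∃ i, G.Adj x (b (i + 1)) := ⟨k - 1, by rwa [Nat.sub_add_cancel hk]⟩
  have hmin {m : ℕ} (hm : 1 ≤ m) (hxm : G.Adj x (b m)) : Nat.find hex + 1 ≤ m := by
    have := Nat.find_min' hex (m := m - 1) (by rwa [Nat.sub_add_cancel hm])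
    omega
  have hle : Nat.find hex + 1 ≤ d := (hmin hk hxk).trans hkd
  by_cases hxi : G.Adj x (b (Nat.find hex))
  · have hzero : Nat.find hex = 0 := by
      by_contra hpos
      have := hmin (Nat.pos_of_ne_zero hpos) hxi
      omega
    exact ⟨Nat.find hex, c₂, hle, Nat.find_spec hex, h.adj_s_c₂, by rw [hzero]; exact h.not_adj_c₂,
      fun m hm hmd hxm => ⟨hmin hm hxm, h.adj_c₂ m hm hmd⟩⟩
  · exact ⟨Nat.find hex, x, hle, Nat.find_spec hex, hsx, hxi, fun m hm _ hxm => ⟨hmin hm hxm, hxm⟩⟩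

theorem exists_last_adj (h : IsWeakAW G d b c₁ c₂ s) (hsx : G.Adj s x) {k : ℕ} (hk : 1 ≤ k)
    (hkd : k ≤ d) (hxk : G.Adj x (b k)) :
    ∃ j g, 1 ≤ j ∧ j ≤ d ∧ G.Adj x (b j) ∧ G.Adj s g ∧ ¬ G.Adj g (b (j + 1)) ∧
      ∀ m, 1 ≤ m → m ≤ d → G.Adj x (b m) → m ≤ j ∧ G.Adj g (b m) := by
  obtain ⟨i, g, hid, hxi, hsg, hgi, hg⟩ := h.reverse.exists_first_adj hsx (k := d + 1 - k)
    (by omega) (by omega) (by rwa [Nat.sub_sub_self (by omega)])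
  refine ⟨d - i, g, by omega, by omega, by rwa [Nat.add_sub_add_right] at hxi, hsg,
    by rwa [Nat.sub_add_comm (by omega)] at hgi, fun m hm hmd hxm => ?_⟩
  obtain ⟨him, hgm⟩ := hg (d + 1 - m) (by omega) (by omega) (by rwa [Nat.sub_sub_self (by omega)])
  rw [Nat.sub_sub_self (by omega)] at hgm
  exact ⟨by omega, hgm⟩

variable {t : V}

theorem not_adj_of_not_adj (h : IsWeakAW G d b c₁ c₂ s) (hG : IsLocallyInterval G 9)
    (hsx : G.Adj s x) (hst : G.Adj s t) (htx : t ≠ x) (hadj : ¬ G.Adj t x) {i : ℕ}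
    (hi : i ≤ d + 1) (hxi : G.Adj x (b i)) : ¬ G.Adj t (b i) := fun hti =>
  hadj (hG.adj_of_square (by omega) hst hti hxi.symm hsx.symm (h.s_ne hi) (h.not_adj_s i hi) htx)

theorem not_adj_of_not_adj_of_adj (h : IsWeakAW G d b c₁ c₂ s) (hG : IsLocallyInterval G 9)
    (hsx : G.Adj s x) (hst : G.Adj s t) (htx : t ≠ x) (hadj : ¬ G.Adj t x) {i j : ℕ}
    (hi : i ≤ d + 1) (hj : j ≤ d + 1) (hij : G.Adj (b i) (b j)) (hxi : G.Adj x (b i)) :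
    ¬ G.Adj t (b j) := fun htj =>
  hadj (hG.adj_of_walk hst hsx htx htj hxi (h.s_ne hj) (.cons hij.symm .nil)
    (by simp) (by simp [h.not_adj_s i hi, h.not_adj_s j hj]))

/-- If `t` and `x` were not adjacent, then `t`, `b i`, `b (j + 1)` would be an asteroidal triple:
`b i` and `b (j + 1)` are joined through `x`, so the length of the base does not matter. -/
theorem adj_of_adj_of_adj (h : IsWeakAW G d b c₁ c₂ s) (hG : IsLocallyInterval G 9)
    (hsx : G.Adj s x) {i j : ℕ} (hij : i + 2 ≤ j) (hjd : j ≤ d) (hxi : G.Adj x (b (i + 1)))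
    (hxj : G.Adj x (b j)) {g₁ g₂ : V} (hsg₁ : G.Adj s g₁) (hg₁i : G.Adj g₁ (b (i + 1)))
    (hg₁j : ¬ G.Adj g₁ (b (j + 1))) (hsg₂ : G.Adj s g₂) (hg₂j : G.Adj g₂ (b j))
    (hg₂i : ¬ G.Adj g₂ (b i)) (hst : G.Adj s t) (htx : t ≠ x) : G.Adj t x := by
  have hbi : G.Adj (b (i + 1)) (b i) := (h.path.adj_succ (by omega)).symm
  have hbj : G.Adj (b j) (b (j + 1)) := h.path.adj_succ (by omega)
  have not_adj_b {p q : ℕ} (hp : p + 2 ≤ q) (hq : q ≤ d + 1) : ¬ G.Adj (b q) (b p) := by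
    rw [h.path.adj_iff _ hq _ (by omega)]
    omega
  by_contra hadj
  have hti := h.not_adj_of_not_adj_of_adj hG hsx hst htx hadj (by omega) (by omega) hbi hxi
  have hti' := h.not_adj_of_not_adj hG hsx hst htx hadj (by omega) hxi
  have htj := h.not_adj_of_not_adj hG hsx hst htx hadj (by omega) hxj
  have htj' := h.not_adj_of_not_adj_of_adj hG hsx hst htx hadj (by omega) (by omega) hbj hxj
  refine hG.not_asteroidal [t, s, x, g₁, g₂, b i, b (i + 1), b j, b (j + 1)] le_rfl
    (h.ne_of_adj hst (by omega)) (h.ne_of_adj hst (by omega))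
    (.cons hst.symm (.cons hsg₁ (.cons hg₁i (.cons hbi .nil))))
    (.cons hst.symm (.cons hsg₂ (.cons hg₂j (.cons hbj .nil))))
    (.cons hbi.symm (.cons hxi.symm (.cons hxj (.cons hbj .nil))))
    (by simp) (by simp) (by simp) ?_ ?_ ?_
  · have hsj' : ¬ G.Adj s (b (j + 1)) := h.not_adj_s _ (by omega)
    have hij' : ¬ G.Adj (b (j + 1)) (b (i + 1)) := not_adj_b (by omega) (by omega)
    have hij'' : ¬ G.Adj (b (j + 1)) (b i) := not_adj_b (by omega) (by omega)
    simp [G.adj_comm (b (j + 1)) t, G.adj_comm (b (j + 1)) s, G.adj_comm (b (j + 1)) g₁, htj', hsj',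
      hg₁j, hij', hij'']
  · have hsi : ¬ G.Adj s (b i) := h.not_adj_s _ (by omega)
    have hji : ¬ G.Adj (b j) (b i) := not_adj_b hij (by omega)
    have hji' : ¬ G.Adj (b (j + 1)) (b i) := not_adj_b (by omega) (by omega)
    simp [G.adj_comm (b i), hti, hsi, hg₂i, hji, hji']
  · simp [hti, hti', hadj, htj, htj']

theorem adj_of_adj_base (h : IsWeakAW G d b c₁ c₂ s) (hG : IsLocallyInterval G 9)
    (hsx : G.Adj s x) {k : ℕ} (hk : 1 ≤ k) (hkd : k ≤ d) (hxk : G.Adj x (b k))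
    (hst : G.Adj s t) (htx : t ≠ x) : G.Adj t x := by
  obtain ⟨i, g₂, hid, hxi, hsg₂, hg₂i, hfirst⟩ := h.exists_first_adj hsx hk hkd hxk
  obtain ⟨j, g₁, hj, hjd, hxj, hsg₁, hg₁j, hlast⟩ := h.exists_last_adj hsx hk hkd hxk
  have hij : i + 2 ≤ j := by
    obtain ⟨m, hm, hmd, hmk, hxm⟩ := h.exists_ne_adj_base hG hsx hk hkd hxk
    have := (hfirst k hk hkd hxk).1
    have := (hfirst m hm hmd hxm).1
    have := (hlast k hk hkd hxk).1
    have := (hlast m hm hmd hxm).1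
    omega
  exact h.adj_of_adj_of_adj hG hsx hij hjd hxi hxj hsg₁ (hlast (i + 1) (by omega) hid hxi).2 hg₁j
    hsg₂ (hfirst j hj hjd hxj).2 hg₂i hst htx

end Neighbors

theorem mem_commonNeighborhood_iff (h : IsWeakAW G d b c₁ c₂ s) {x : V} :
    x ∈ commonNeighborhood G s (b '' Set.Icc 1 d) ↔
      G.Adj s x ∧ ∃ k, 1 ≤ k ∧ k ≤ d ∧ G.Adj x (b k) := by
  constructor
  · rintro ⟨hsx, -, -, ⟨k, ⟨hk, hkd⟩, rfl⟩, hkx⟩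
    exact ⟨hsx, k, hk, hkd, hkx.symm⟩
  · rintro ⟨hsx, k, hk, hkd, hxk⟩
    refine ⟨hsx, ?_, b k, ⟨k, ⟨hk, hkd⟩, rfl⟩, hxk.symm⟩
    rintro ⟨m, ⟨-, hmd⟩, rfl⟩
    exact h.not_adj_s m (by omega) hsx

theorem isClique_commonNeighborhood (h : IsWeakAW G d b c₁ c₂ s) (hG : IsLocallyInterval G 9) :
    G.IsClique (commonNeighborhood G s (b '' Set.Icc 1 d)) := by
  intro y hy x hx hyx
  obtain ⟨hsx, k, hk, hkd, hxk⟩ := h.mem_commonNeighborhood_iff.1 hx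
  exact h.adj_of_adj_base hG hsx hk hkd hxk hy.1 hyx

section Replacement

variable {z : V}

theorem adj_of_adj_base_of_forall_not_adj (h : IsWeakAW G d b c₁ c₂ s)
    (hG : IsLocallyInterval G 9) (hsz : G.Adj s z) (hz : ∀ k, 1 ≤ k → k ≤ d → ¬ G.Adj z (b k))
    {x : V} (hsx : G.Adj s x) {k : ℕ} (hk : 1 ≤ k) (hkd : k ≤ d) (hxk : G.Adj x (b k)) :
    G.Adj z x := by
  refine h.adj_of_adj_base hG hsx hk hkd hxk hsz ?_
  rintro rfl
  exact hz k hk hkd hxk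

theorem not_adj_zero (h : IsWeakAW G d b c₁ c₂ s) (hG : IsLocallyInterval G 9)
    (hsz : G.Adj s z) (hz : ∀ k, 1 ≤ k → k ≤ d → ¬ G.Adj z (b k)) : ¬ G.Adj z (b 0) := by
  intro hz0
  have htwo := h.two_le
  have hc₂ := h.adj_c₂ 1 le_rfl (by omega)
  have hzc₂ := h.adj_of_adj_base_of_forall_not_adj hG hsz hz h.adj_s_c₂ le_rfl (by omega) hc₂
  exact h.not_adj_c₂ (hG.adj_of_square (by omega) hzc₂ hc₂ (h.path.adj_succ (by omega)).symm
    hz0.symm (h.ne_of_adj hsz (by omega)) (hz 1 le_rfl (by omega))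
    (h.ne_of_adj h.adj_s_c₂ (by omega)))

theorem of_adj (h : IsWeakAW G d b c₁ c₂ s) (hG : IsLocallyInterval G 9)
    (hsz : G.Adj s z) (hz : ∀ k, 1 ≤ k → k ≤ d → ¬ G.Adj z (b k)) : IsWeakAW G d b c₁ c₂ z := by
  have htwo := h.two_le
  refine { h with
    adj_s_c₁ := h.adj_of_adj_base_of_forall_not_adj hG hsz hz h.adj_s_c₁ le_rfl (by omega)
      (h.adj_c₁ 1 le_rfl (by omega))
    adj_s_c₂ := h.adj_of_adj_base_of_forall_not_adj hG hsz hz h.adj_s_c₂ le_rfl (by omega)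
      (h.adj_c₂ 1 le_rfl (by omega))
    not_adj_s := fun i hi => ?_ }
  rcases Nat.eq_zero_or_pos i with rfl | hi0
  · exact h.not_adj_zero hG hsz hz
  rcases hi.eq_or_lt with rfl | hi
  · have := h.reverse.not_adj_zero hG hsz fun k _ _ => hz _ (by omega) (by omega)
    simpa using this
  · exact hz i hi0 (by omega)

theorem commonNeighborhood_eq_of_adj (h : IsWeakAW G d b c₁ c₂ s) (hG : IsLocallyInterval G 9)
    (hsz : G.Adj s z) (hz : ∀ k, 1 ≤ k → k ≤ d → ¬ G.Adj z (b k)) :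
    commonNeighborhood G z (b '' Set.Icc 1 d) = commonNeighborhood G s (b '' Set.Icc 1 d) := by
  have h' := h.of_adj hG hsz hz
  ext x
  rw [h.mem_commonNeighborhood_iff, h'.mem_commonNeighborhood_iff]
  refine and_congr_left fun ⟨k, hk, hkd, hxk⟩ => ⟨fun hzx => ?_, fun hsx => ?_⟩
  · exact h'.adj_of_adj_base_of_forall_not_adj hG hsz.symm
      (fun m _ hmd => h.not_adj_s m (by omega)) hzx hk hkd hxk
  · exact h.adj_of_adj_base_of_forall_not_adj hG hsz hz hsx hk hkd hxk

end Replacement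

end IsWeakAW

theorem componentAvoiding_induction {V : Type*} {G : SimpleGraph V} {s : V} {B : Set V}
    {P : V → Prop} (base : P s)
    (step : ∀ u v, P u → G.Adj u v → v ∉ commonNeighborhood G s B → P v) {y : V}
    (hy : y ∈ componentAvoiding G s B) : P y := by
  obtain ⟨y, hy, rfl⟩ := hy
  have hreach := (SimpleGraph.ConnectedComponent.exact hy).symm
  rw [SimpleGraph.reachable_iff_reflTransGen] at hreach
  clear hy
  induction hreach with
  | refl => exact base
  | @tail u v _ huv ih => exact step u v ih huv v.2

/-- Nine is the number of vertices of the configuration ruled out in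
`IsWeakAW.adj_of_adj_of_adj`. -/
theorem theorem5_general {V : Type*} {G : SimpleGraph V} (hG : IsLocallyInterval G 9) {d : ℕ}
    {b : ℕ → V} {c₁ c₂ s : V} (h : IsWeakAW G d b c₁ c₂ s) :
    (∀ y ∈ componentAvoiding G s (b '' Set.Icc 1 d),
      ∀ x ∈ commonNeighborhood G s (b '' Set.Icc 1 d), G.Adj y x) ∧
    G.IsClique (commonNeighborhood G s (b '' Set.Icc 1 d)) := by
  refine ⟨fun y hy x hx => ?_, h.isClique_commonNeighborhood hG⟩
  obtain ⟨-, hC⟩ : IsWeakAW G d b c₁ c₂ y ∧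
      commonNeighborhood G y (b '' Set.Icc 1 d) = commonNeighborhood G s (b '' Set.Icc 1 d) := by
    refine componentAvoiding_induction (P := fun y => IsWeakAW G d b c₁ c₂ y ∧
      commonNeighborhood G y _ = commonNeighborhood G s _) ⟨h, rfl⟩ ?_ hy
    rintro u v ⟨hu, hCu⟩ huv hv
    rw [← hCu, hu.mem_commonNeighborhood_iff] at hv
    push Not at hv
    exact ⟨hu.of_adj hG huv (hv huv), (hu.commonNeighborhood_eq_of_adj hG huv (hv huv)).trans hCu⟩
  rw [← hC] at hx
  exact hx.1

section Witnesses

variable {V : Type*} {G : SimpleGraph V} {d : ℕ} {s : V} {b : Fin (d + 2) → V}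

theorem IsInducedPath.inducesPath (h : IsInducedPath G d b) :
    InducesPath G (d + 1) (fun i => b (Fin.clamp i (d + 1))) where
  injOn i hi j hj hij := by
    simpa [Fin.ext_iff, Set.mem_Iic.1 hi, Set.mem_Iic.1 hj] using h.1 hij
  adj_iff i hi j hj := by simp [h.2, hi, hj]

theorem IsDaggerAW.isWeakAW {c : V} (h : IsDaggerAW G d s c b) :
    IsWeakAW G d (fun i => b (Fin.clamp i (d + 1))) c c s where
  two_le := by have := h.three_le; omega
  path := h.path.inducesPath
  not_adj_s _ _ := h.not_adj_s _
  adj_s_c₁ := h.adj_s_c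
  adj_s_c₂ := h.adj_s_c
  adj_c₁ i _ _ := by rw [h.adj_c, Fin.coe_clamp]; omega
  adj_c₂ i _ _ := by rw [h.adj_c, Fin.coe_clamp]; omega
  not_adj_c₁ := by rw [h.adj_c, Fin.coe_clamp]; omega
  not_adj_c₂ := by rw [h.adj_c, Fin.coe_clamp]; omega

theorem IsDoubleDaggerAW.isWeakAW {c₁ c₂ : V} (h : IsDoubleDaggerAW G d s c₁ c₂ b) :
    IsWeakAW G d (fun i => b (Fin.clamp i (d + 1))) c₁ c₂ s where
  two_le := h.two_le
  path := h.path.inducesPath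
  not_adj_s _ _ := h.not_adj_s _
  adj_s_c₁ := h.adj_s_c₁
  adj_s_c₂ := h.adj_s_c₂
  adj_c₁ i _ _ := by rw [h.adj_c₁, Fin.coe_clamp]; omega
  adj_c₂ i _ _ := by rw [h.adj_c₂, Fin.coe_clamp]; omega
  not_adj_c₁ := by rw [h.adj_c₁, Fin.coe_clamp]; omega
  not_adj_c₂ := by rw [h.adj_c₂, Fin.coe_clamp]; omega

theorem baseSet_eq_image (d : ℕ) (b : Fin (d + 2) → V) :
    baseSet d b = (fun i => b (Fin.clamp i (d + 1))) '' Set.Icc 1 d := by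
  ext v
  constructor
  · rintro ⟨i, hi, hid, rfl⟩
    exact ⟨i, ⟨hi, hid⟩, congrArg b (Fin.ext (by rw [Fin.coe_clamp]; omega))⟩
  · rintro ⟨i, ⟨hi, hid⟩, rfl⟩
    exact ⟨_, by rw [Fin.coe_clamp]; omega, by rw [Fin.coe_clamp]; omega, rfl⟩

end Witnesses

theorem theorem5 {V : Type*} (G : SimpleGraph V) (hG : IsPrereduced G)
    (d : ℕ) (s : V) (b : Fin (d + 2) → V)
    (hW : (∃ c : V, IsDaggerAW G d s c b) ∨ (∃ c₁ c₂ : V, IsDoubleDaggerAW G d s c₁ c₂ b)) :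
    (∀ y ∈ componentAvoiding G s (baseSet d b),
      ∀ x ∈ commonNeighborhood G s (baseSet d b), G.Adj y x) ∧
    G.IsClique (commonNeighborhood G s (baseSet d b)) := by
  rw [baseSet_eq_image]
  obtain ⟨c, h⟩ | ⟨c₁, c₂, h⟩ := hW <;>
    exact theorem5_general (hG.isLocallyInterval.mono (by norm_num)) h.isWeakAW
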